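/- For a finite graph $G$ let $m(G)=\max\{e(J)/v(J) : J\subseteq G,\ v(J)\ge 1\}$ be its maximum density (with $m(G)=0$ if $G$ has no vertices) and, if $v(G)\ge 3$, let $m_2(G)=\max\{(e(J)-1)/(v(J)-2) : J\subseteq G,\ v(J)\ge 3\}$ be its maximum $2$-density, where $J$ ranges over subgraphs of $G$, and $v(J)$, $e(J)$ are the numbers of vertices and edges of $J$. An orientation of a graph is obtained by giving each edge exactly one of its two directions. Write $G\to\vec H$ if every orientation of $G$ contains a copy of the oriented graph $\vec H$ as a (not necessarily induced) subdigraph. Theorem. Let $\ell\ge 5$ and let $C_\ell$ be the cycle on $\ell$ vertices. Then $m_2(C_\ell)=\frac{\ell-1}{\ell-2}$, and for every orientation $\vec C$ of $C_\ell$ and every finite graph $G$ with $m(G)<m_2(C_\ell)$ we have $G\not\to\vec C$; that is, $G$ has an orientation that contains no copy of $\vec C$. -/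

import Mathlib

noncomputable section

namespace OrientationRamsey

/-- The number `v(J)` of vertices of a subgraph. -/
def numVerts {V : Type*} {G : SimpleGraph V} (J : G.Subgraph) : ℕ := J.verts.ncard

/-- The number `e(J)` of edges of a subgraph. -/
def numEdges {V : Type*} {G : SimpleGraph V} (J : G.Subgraph) : ℕ := J.edgeSet.ncard

/-- The set of all ratios `e(J) / v(J)`, over the subgraphs `J ⊆ G` with `v(J) ≥ 1`. -/
def densities {V : Type*} (G : SimpleGraph V) : Set ℝ :=
  {r | ∃ J : G.Subgraph, 1 ≤ numVerts J ∧ r = (numEdges J : ℝ) / (numVerts J : ℝ)}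

/-- The maximum density `m(G)` of a finite graph (`0` for the graph without vertices). -/
def maxDensity {V : Type*} (G : SimpleGraph V) : ℝ := sSup (densities G)

/-- The set of all ratios `(e(J) - 1) / (v(J) - 2)`, over the subgraphs `J ⊆ G` with
`v(J) ≥ 3`. -/
def twoDensities {V : Type*} (G : SimpleGraph V) : Set ℝ :=
  {r | ∃ J : G.Subgraph, 3 ≤ numVerts J ∧
    r = ((numEdges J : ℝ) - 1) / ((numVerts J : ℝ) - 2)}

/-- The maximum 2-density `m₂(G)` of a finite graph with at least three vertices. -/
def maxTwoDensity {V : Type*} (G : SimpleGraph V) : ℝ := sSup (twoDensities G)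

/-- For a finite nonempty graph the supremum in `maxDensity` is a maximum. -/
theorem isGreatest_maxDensity {V : Type*} [Finite V] [Nonempty V] (G : SimpleGraph V) :
    IsGreatest (densities G) (maxDensity G) := by
  have hfin : (densities G).Finite := by
    refine (Set.finite_range
      (fun J : G.Subgraph => (numEdges J : ℝ) / (numVerts J : ℝ))).subset ?_
    rintro r ⟨J, -, rfl⟩
    exact ⟨J, rfl⟩
  have hne : (densities G).Nonempty := by
    refine ⟨_, ⊤, ?_, rfl⟩
    have h : 0 < Nat.card V := Nat.card_pos
    rw [numVerts, SimpleGraph.Subgraph.verts_top, Set.ncard_univ]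
    exact h
  exact ⟨hne.csSup_mem hfin, fun r hr => le_csSup hfin.bddAbove hr⟩

/-- For a finite graph with at least three vertices the supremum in `maxTwoDensity` is a
maximum. -/
theorem isGreatest_maxTwoDensity {V : Type*} [Finite V] (hV : 3 ≤ Nat.card V)
    (G : SimpleGraph V) : IsGreatest (twoDensities G) (maxTwoDensity G) := by
  have hfin : (twoDensities G).Finite := by
    refine (Set.finite_range (fun J : G.Subgraph =>
      ((numEdges J : ℝ) - 1) / ((numVerts J : ℝ) - 2))).subset ?_
    rintro r ⟨J, -, rfl⟩
    exact ⟨J, rfl⟩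
  have hne : (twoDensities G).Nonempty :=
    ⟨_, ⊤, by simpa [numVerts, Set.ncard_univ] using hV, rfl⟩
  exact ⟨hne.csSup_mem hfin, fun r hr => le_csSup hfin.bddAbove hr⟩

/-- `D` is an orientation of `G`: each edge of `G` gives exactly one arc of `D`, and there are
no other arcs. -/
structure IsOrientation {V : Type*} (D : Digraph V) (G : SimpleGraph V) : Prop where
  adj_iff : ∀ u v : V, G.Adj u v ↔ D.Adj u v ∨ D.Adj v u
  asymm : ∀ u v : V, D.Adj u v → ¬ D.Adj v u

/-- `D` contains a (not necessarily induced) copy of `H` as a subdigraph. -/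
def ContainsCopy {V W : Type*} (D : Digraph V) (H : Digraph W) : Prop :=
  ∃ f : W → V, Function.Injective f ∧ ∀ a b : W, H.Adj a b → D.Adj (f a) (f b)

/-- `G → H`: every orientation of `G` contains a copy of `H`. -/
def Arrows {V W : Type*} (G : SimpleGraph V) (H : Digraph W) : Prop :=
  ∀ D : Digraph V, IsOrientation D G → ContainsCopy D H

end OrientationRamsey

end

namespace OrientationRamsey

/-! The density hypothesis says that every vertex set induces average degree below 2(ℓ-1)/(ℓ-2),
which is at most 8/3. If the oriented cycle has three consecutive arcs, then `G` is 2-degenerate,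
hence 3-colourable, and orienting edges towards the larger colour leaves no directed walk of length
three (`not_arrows_of_coloring_three`).

Otherwise induct on vertex sets. Delete a vertex `v` together with a set `A` of neighbours of degree
at most 2, orient the rest, and put the arcs back in the pattern rest → v → A → rest. A new copy
would contain three consecutive arcs or an out-fork centred at `v` (`exists_orientation_of_sdiff`).
A set with no deletable configuration has large average degree by discharging: at least 12/5 when
`A` has at most one vertex, which settles ℓ ≥ 7, and at least 8/3 when out-forks are absent and `A`
may be larger. For ℓ = 5, 6 the cycle or its reverse has no out-fork, and reversal is harmless. -/

/-- The digraph obtained by reversing all arcs. -/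
def reverse {V : Type*} (D : Digraph V) : Digraph V := ⟨fun x y => D.Adj y x⟩

/-- The graph `G` with only the edges inside `S` kept. -/
def restrict {V : Type*} (G : SimpleGraph V) (S : Finset V) : SimpleGraph V where
  Adj x y := G.Adj x y ∧ x ∈ S ∧ y ∈ S
  symm := ⟨fun _ _ h => ⟨h.1.symm, h.2.2, h.2.1⟩⟩
  loopless := ⟨fun _ h => h.1.ne rfl⟩

/-- `C` has three consecutive arcs. -/
def HasThreeWalk {W : Type*} (C : Digraph W) : Prop :=
  ∃ x y z w, C.Adj x y ∧ C.Adj y z ∧ C.Adj z w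

/-- Two directed paths of length two leave a common vertex of `C`. -/
def HasOutFork {W : Type*} (C : Digraph W) : Prop :=
  ∃ p x y z q, x ≠ z ∧ C.Adj y x ∧ C.Adj x p ∧ C.Adj y z ∧ C.Adj z q

theorem IsOrientation.reverse {V : Type*} {D : Digraph V} {G : SimpleGraph V}
    (h : IsOrientation D G) : IsOrientation (reverse D) G :=
  ⟨fun u v => by rw [h.adj_iff]; exact or_comm, fun u v => h.asymm v u⟩

theorem ContainsCopy.reverse {V W : Type*} {D : Digraph V} {C : Digraph W}
    (h : ContainsCopy D C) : ContainsCopy (reverse D) (reverse C) := by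
  obtain ⟨f, hf, hadj⟩ := h
  exact ⟨f, hf, fun a b hab => hadj b a hab⟩

/-- A digraph map from an orientation reflects arcs between adjacent vertices. -/
theorem IsOrientation.adj_of_adj_map {V W : Type*} {D : Digraph V} {C : Digraph W}
    {H : SimpleGraph W} (hC : IsOrientation C H) (hD : ∀ u v, D.Adj u v → ¬ D.Adj v u)
    {f : W → V} (hf : ∀ a b, C.Adj a b → D.Adj (f a) (f b)) {a b : W} (hab : H.Adj a b)
    (h : D.Adj (f a) (f b)) : C.Adj a b := by
  rcases (hC.adj_iff a b).1 hab with h1 | h1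
  · exact h1
  · exact absurd (hf b a h1) (hD _ _ h)

/-! ### Extending an orientation over a deleted star -/

section Extend

variable {V W : Type*} [DecidableEq V]

theorem exists_orientation_of_sdiff (G : SimpleGraph V) [DecidableRel G.Adj] (S A : Finset V)
    (v : V) (C : Digraph W) (H : SimpleGraph W) (hC : IsOrientation C H)
    (hH : ∀ i j, ∃ k, k ≠ j ∧ H.Adj i k) (hpath : ¬ HasThreeWalk C)
    (hfork : A.card ≤ 1 ∨ ¬ HasOutFork C)
    (hvA : ∀ a ∈ A, G.Adj v a) (hind : ∀ a ∈ A, ∀ b ∈ A, ¬ G.Adj a b)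
    (hdeg : ∀ a ∈ A, (S.filter (G.Adj a)).card ≤ 2) (hvS : v ∈ S)
    (hv : ((S.filter (G.Adj v)) \ A).card ≤ 1)
    (D' : Digraph V) (hD' : IsOrientation D' (restrict G (S \ insert v A)))
    (hcopy : ¬ ContainsCopy D' C) :
    ∃ D : Digraph V, IsOrientation D (restrict G S) ∧ ¬ ContainsCopy D C := by
  have hvnA : v ∉ A := fun h => (hvA v h).ne rfl
  have hD'in : ∀ x y, D'.Adj x y →
      G.Adj x y ∧ (x ∈ S ∧ x ≠ v ∧ x ∉ A) ∧ (y ∈ S ∧ y ≠ v ∧ y ∉ A) := by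
    intro x y h
    have := (hD'.adj_iff x y).2 (Or.inl h)
    simpa [restrict, not_or] using this
  -- All new arcs follow the pattern rest → v → A → rest.
  let R : V → V → Prop := fun x y =>
    (x ≠ v ∧ x ∉ A ∧ y = v) ∨ (x = v ∧ y ∈ A) ∨ (x ∈ A ∧ y ≠ v ∧ y ∉ A)
  let D : Digraph V := ⟨fun x y => D'.Adj x y ∨ (G.Adj x y ∧ x ∈ S ∧ y ∈ S ∧ R x y)⟩
  have hDG : ∀ x y, D.Adj x y → G.Adj x y ∧ x ∈ S ∧ y ∈ S := by
    rintro x y (h | h)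
    · have := hD'in x y h; tauto
    · tauto
  have hO : IsOrientation D (restrict G S) := by
    constructor
    · intro x y
      constructor
      · rintro ⟨hxy, hx, hy⟩
        by_cases hT : (x ≠ v ∧ x ∉ A) ∧ (y ≠ v ∧ y ∉ A)
        · have : (restrict G (S \ insert v A)).Adj x y := by
            simp only [restrict, Finset.mem_sdiff, Finset.mem_insert]
            tauto
          rcases (hD'.adj_iff x y).1 this with h | h
          · exact Or.inl (Or.inl h)
          · exact Or.inr (Or.inl h)
        · have h1 : R x y ∨ R y x := by
            have h2 : x = v → y ≠ v := by rintro rfl rfl; exact hxy.ne rfl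
            have h3 : x ∈ A → y ∉ A := fun ha hb => hind x ha y hb hxy
            simp only [R]
            by_cases x = v <;> by_cases y = v <;> by_cases x ∈ A <;> by_cases y ∈ A <;> simp_all
          rcases h1 with h | h
          · exact Or.inl (Or.inr ⟨hxy, hx, hy, h⟩)
          · exact Or.inr (Or.inr ⟨hxy.symm, hy, hx, h⟩)
      · rintro (h | h)
        · exact hDG x y h
        · obtain ⟨h1, h2, h3⟩ := hDG y x h
          exact ⟨h1.symm, h3, h2⟩
    · rintro x y (h | ⟨h1, h2, h3, h⟩) (h' | ⟨h1', h2', h3', h'⟩)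
      · exact hD'.asymm x y h h'
      · have := hD'in x y h
        simp only [R] at h'; tauto
      · have := hD'in y x h'
        simp only [R] at h; tauto
      · simp only [R] at h h'
        have : x = v → x ∉ A := by rintro rfl; exact hvnA
        have : y = v → y ∉ A := by rintro rfl; exact hvnA
        tauto
  refine ⟨D, hO, ?_⟩
  rintro ⟨f, hinj, hf⟩
  have hadj : ∀ {a b}, H.Adj a b → G.Adj (f a) (f b) ∧ f a ∈ S ∧ f b ∈ S := by
    intro a b hab
    rcases (hC.adj_iff a b).1 hab with h | h
    · exact hDG _ _ (hf _ _ h)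
    · have := hDG _ _ (hf _ _ h)
      exact ⟨this.1.symm, this.2.2, this.2.1⟩
  have hback : ∀ {a b}, H.Adj a b → R (f a) (f b) → C.Adj a b := by
    intro a b hab hR
    obtain ⟨h1, h2, h3⟩ := hadj hab
    exact hC.adj_of_adj_map hO.asymm hf hab (Or.inr ⟨h1, h2, h3, hR⟩)
  -- A copy using an edge from `v` to `A` continues v → A → rest. Its other edge at `v` either comes
  -- from the rest, giving three consecutive arcs, or goes into `A`, giving an out-fork.
  have key : ∀ i j, H.Adj i j → f i = v → f j ∈ A → False := by
    intro i j hij hi hj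
    have fwd : ∀ j, H.Adj i j → f j ∈ A → ∃ k, C.Adj i j ∧ C.Adj j k := by
      intro j hij hj
      obtain ⟨k, hki, hjk⟩ := hH j i
      have hkv : f k ≠ v := fun h => hki (hinj (h.trans hi.symm))
      exact ⟨k, hback hij (Or.inr (Or.inl ⟨hi, hj⟩)), hback hjk
        (Or.inr (Or.inr ⟨hj, hkv, fun h => hind _ hj _ h (hadj hjk).1⟩))⟩
    obtain ⟨k, h1, h2⟩ := fwd j hij hj
    obtain ⟨j', hj', hij'⟩ := hH i j
    by_cases hA : f j' ∈ A
    · obtain ⟨k', h1', h2'⟩ := fwd j' hij' hA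
      rcases hfork with hfork | hfork
      · exact hj' (hinj (Finset.card_le_one.1 hfork _ hA _ hj))
      · exact hfork ⟨k', j', i, j, k, hj', h1', h2', h1, h2⟩
    · have h3 : C.Adj j' i := hback hij'.symm
        (Or.inl ⟨fun h => hij'.ne (hinj (hi.trans h.symm)), hA, hi⟩)
      exact hpath ⟨j', i, j, k, h3, h1, h2⟩
  have hnv : ∀ i, f i ≠ v := by
    intro i hi
    obtain ⟨j, -, hij⟩ := hH i i
    obtain ⟨k, hkj, hik⟩ := hH i j
    have hm : ∀ {j}, H.Adj i j → f j ∈ (S.filter (G.Adj v)) \ A := by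
      intro j hij
      have := hadj hij
      rw [hi] at this
      simp only [Finset.mem_sdiff, Finset.mem_filter]
      exact ⟨⟨this.2.2, this.1⟩, fun h => key i j hij hi h⟩
    exact hkj (hinj (Finset.card_le_one.1 hv _ (hm hik) _ (hm hij)))
  -- A vertex of `A` in the copy would have two neighbours there besides `v`, so degree at least 3.
  have hnA : ∀ i, f i ∉ A := by
    intro i hi
    obtain ⟨j, -, hij⟩ := hH i i
    obtain ⟨k, hkj, hik⟩ := hH i j
    have hsub : ({f j, f k, v} : Finset V) ⊆ S.filter (G.Adj (f i)) := by
      intro x hx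
      simp only [Finset.mem_insert, Finset.mem_singleton] at hx
      rw [Finset.mem_filter]
      rcases hx with rfl | rfl | rfl
      · exact ⟨(hadj hij).2.2, (hadj hij).1⟩
      · exact ⟨(hadj hik).2.2, (hadj hik).1⟩
      · exact ⟨hvS, (hvA _ hi).symm⟩
    have hcard : ({f j, f k, v} : Finset V).card = 3 :=
      Finset.card_eq_three.2 ⟨_, _, _, fun h => hkj (hinj h).symm, hnv j, hnv k, rfl⟩
    have := Finset.card_le_card hsub
    have := hdeg _ hi
    omega
  refine hcopy ⟨f, hinj, fun a b hab => ?_⟩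
  rcases hf a b hab with h | ⟨-, -, -, h⟩
  · exact h
  · have := hnv a; have := hnv b; have := hnA a; have := hnA b
    simp only [R] at h; tauto

end Extend

/-! ### Lower bounds on the average degree -/

section Discharging

variable {V : Type*} (G : SimpleGraph V) [DecidableRel G.Adj] (S : Finset V)

/-- The number of neighbours of `v` in `S`. -/
def degIn (v : V) : ℕ := (S.filter (G.Adj v)).card

theorem sum_card_degIn_eq_two :
    ∑ v ∈ S, (S.filter (fun u => G.Adj v u ∧ degIn G S u = 2)).card =
      2 * (S.filter (fun v => degIn G S v = 2)).card := by
  have h := Finset.sum_card_bipartiteAbove_eq_sum_card_bipartiteBelow (s := S)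
    (t := S.filter (fun v => degIn G S v = 2)) G.Adj
  have h1 : ∀ v, (S.filter (fun u => G.Adj v u ∧ degIn G S u = 2)) =
      Finset.bipartiteAbove G.Adj (S.filter (fun v => degIn G S v = 2)) v := by
    intro v
    ext u
    simp only [Finset.bipartiteAbove, Finset.mem_filter]
    tauto
  simp only [h1]
  rw [h, Finset.sum_congr rfl (g := fun _ => 2), Finset.sum_const, smul_eq_mul, mul_comm]
  intro u hu
  rw [← (Finset.mem_filter.1 hu).2, degIn, Finset.bipartiteBelow]
  simp only [G.adj_comm]

theorem three_mul_card_le (h2 : ∀ v ∈ S, 2 ≤ degIn G S v) :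
    3 * S.card ≤ ∑ v ∈ S, degIn G S v + (S.filter (fun v => degIn G S v = 2)).card := by
  rw [Finset.card_filter, ← Finset.sum_add_distrib, mul_comm, ← smul_eq_mul, ← Finset.sum_const]
  refine Finset.sum_le_sum fun v hv => ?_
  have := h2 v hv
  split_ifs <;> omega

theorem card_degIn_eq_two_eq_zero
    (hadj : ∀ u ∈ S, ∀ v ∈ S, G.Adj u v → degIn G S u = 2 → degIn G S v ≠ 2)
    {v : V} (hv : v ∈ S) (hd : degIn G S v = 2) :
    (S.filter (fun u => G.Adj v u ∧ degIn G S u = 2)).card = 0 := by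
  rw [Finset.card_eq_zero, Finset.filter_eq_empty_iff]
  exact fun u hu h => hadj v hv u hu h.1 hd h.2

/-- Let t count the degree-2 vertices and Σ be the degree sum. They receive 2t edges, all from
vertices of larger degree, and their own degrees add 2t, so 4t ≤ Σ. Combine with 3|S| ≤ Σ + t. -/
theorem twelve_mul_card_le (h2 : ∀ v ∈ S, 2 ≤ degIn G S v)
    (hadj : ∀ u ∈ S, ∀ v ∈ S, G.Adj u v → degIn G S u = 2 → degIn G S v ≠ 2) :
    12 * S.card ≤ 5 * ∑ v ∈ S, degIn G S v := by
  have h1 := sum_card_degIn_eq_two G S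
  have h3 := three_mul_card_le G S h2
  have h4 : ∑ v ∈ S, (S.filter (fun u => G.Adj v u ∧ degIn G S u = 2)).card +
      ∑ v ∈ S, (if degIn G S v = 2 then 2 else 0) ≤ ∑ v ∈ S, degIn G S v := by
    rw [← Finset.sum_add_distrib]
    refine Finset.sum_le_sum fun v hv => ?_
    split_ifs with hd
    · rw [card_degIn_eq_two_eq_zero G S hadj hv hd, hd]
    · exact Finset.card_le_card fun u => by
        simp only [Finset.mem_filter]; tauto
  rw [← Finset.sum_filter, Finset.sum_const, smul_eq_mul] at h4
  omega

/-- Reserving two neighbours of larger degree at each vertex gives 2t + 2|S| ≤ Σ, with t and Σ as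
before. Combine with 3|S| ≤ Σ + t. -/
theorem eight_mul_card_le (h2 : ∀ v ∈ S, 2 ≤ degIn G S v)
    (hbig : ∀ v ∈ S, 2 ≤ (S.filter (fun u => G.Adj v u ∧ degIn G S u ≠ 2)).card) :
    8 * S.card ≤ 3 * ∑ v ∈ S, degIn G S v := by
  have h1 := sum_card_degIn_eq_two G S
  have h3 := three_mul_card_le G S h2
  have h4 : ∑ v ∈ S, (S.filter (fun u => G.Adj v u ∧ degIn G S u = 2)).card +
      ∑ v ∈ S, 2 ≤ ∑ v ∈ S, degIn G S v := by
    rw [← Finset.sum_add_distrib]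
    refine Finset.sum_le_sum fun v hv => ?_
    have h5 := Finset.card_filter_add_card_filter_not (s := S.filter (G.Adj v))
      (fun u => degIn G S u = 2)
    simp only [Finset.filter_filter] at h5
    have := hbig v hv
    rw [degIn]
    simp only [ne_eq] at *
    omega
  rw [Finset.sum_const, smul_eq_mul] at h4
  omega

end Discharging


/-! ### Minimal counterexamples and degeneracy -/

section Induction

variable {V W : Type*} [DecidableEq V]

theorem exists_orientation_restrict [Nonempty W] (G : SimpleGraph V) [DecidableRel G.Adj]
    {n : ℕ} (hn : 3 ≤ n)
    (hdens : ∀ S : Finset V, S.Nonempty → n * ∑ v ∈ S, degIn G S v < 2 * (n + 1) * S.card)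
    (C : Digraph W) (H : SimpleGraph W) (hC : IsOrientation C H)
    (hH : ∀ i j, ∃ k, k ≠ j ∧ H.Adj i k) (hpath : ¬ HasThreeWalk C)
    (hfork : 5 ≤ n ∨ ¬ HasOutFork C) (S : Finset V) :
    ∃ D : Digraph V, IsOrientation D (restrict G S) ∧ ¬ ContainsCopy D C := by
  induction S using Finset.strongInduction with
  | H S ih =>
  rcases S.eq_empty_or_nonempty with rfl | hS
  · refine ⟨⟨fun _ _ => False⟩, ⟨by simp [restrict], by simp⟩, ?_⟩
    rintro ⟨f, -, hf⟩
    obtain ⟨i⟩ := ‹Nonempty W›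
    obtain ⟨j, -, hij⟩ := hH i i
    rcases (hC.adj_iff i j).1 hij with h | h
    · exact hf _ _ h
    · exact hf _ _ h
  have step : ∀ v ∈ S, ∀ A : Finset V, (A.card ≤ 1 ∨ ¬ HasOutFork C) →
      (∀ a ∈ A, G.Adj v a) → (∀ a ∈ A, ∀ b ∈ A, ¬ G.Adj a b) →
      (∀ a ∈ A, degIn G S a ≤ 2) → ((S.filter (G.Adj v)) \ A).card ≤ 1 →
      ∃ D : Digraph V, IsOrientation D (restrict G S) ∧ ¬ ContainsCopy D C := by
    intro v hv A h1 h2 h3 h4 h5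
    obtain ⟨D', hD', hcopy⟩ := ih (S \ insert v A) (by
      refine Finset.ssubset_iff_subset_ne.2 ⟨Finset.sdiff_subset, fun h => ?_⟩
      rw [← h] at hv
      simp at hv)
    exact exists_orientation_of_sdiff G S A v C H hC hH hpath h1 h2 h3 h4 hv h5 D' hD' hcopy
  by_contra hno
  have h2 : ∀ v ∈ S, 2 ≤ degIn G S v := by
    intro v hv
    by_contra hlt
    refine hno (step v hv ∅ (Or.inl (by simp)) (by simp) (by simp) (by simp) ?_)
    rw [Finset.sdiff_empty]
    exact Nat.lt_succ_iff.1 (not_le.1 hlt)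
  have hadj : ∀ u ∈ S, ∀ v ∈ S, G.Adj u v → degIn G S u = 2 → degIn G S v ≠ 2 := by
    intro u hu v hv huv hdu hdv
    refine hno (step u hu {v} (Or.inl (by simp)) (by simpa using huv) (by simp)
      (by simp [hdv]) ?_)
    rw [Finset.card_sdiff_of_subset (by simp [hv, huv])]
    rw [degIn] at hdu
    simp [hdu]
  have hd := hdens S hS
  have hpos := hS.card_pos
  -- For n ≥ 5 the average degree is below 2(n+1)/n ≤ 12/5; for n ≥ 3 it is below 8/3. Without
  -- out-forks, `A` can be the set of all degree-2 neighbours of `v`.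
  rcases hfork with hfork | hfork
  · have := twelve_mul_card_le G S h2 hadj
    nlinarith
  · have := eight_mul_card_le G S h2 (fun v hv => by
      by_contra hlt
      refine hno (step v hv (S.filter (fun u => G.Adj v u ∧ degIn G S u = 2)) (Or.inr hfork)
        (fun a ha => (Finset.mem_filter.1 ha).2.1) (fun a ha b hb hab => ?_)
        (fun a ha => (Finset.mem_filter.1 ha).2.2.le) ?_)
      · rw [Finset.mem_filter] at ha hb
        exact hadj a ha.1 b hb.1 hab ha.2.2 hb.2.2
      · refine le_trans (Finset.card_le_card fun u => ?_) (Nat.lt_succ_iff.1 (not_le.1 hlt))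
        simp only [Finset.mem_sdiff, Finset.mem_filter]
        tauto)
    nlinarith

theorem exists_coloring_three (G : SimpleGraph V) [DecidableRel G.Adj]
    (hdens : ∀ S : Finset V, S.Nonempty → ∑ v ∈ S, degIn G S v < 3 * S.card) (S : Finset V) :
    ∃ h : V → Fin 3, ∀ x ∈ S, ∀ y ∈ S, G.Adj x y → h x ≠ h y := by
  induction S using Finset.strongInduction with
  | H S ih =>
  rcases S.eq_empty_or_nonempty with rfl | hS
  · exact ⟨fun _ => 0, by simp⟩
  obtain ⟨v, hv, hlt⟩ : ∃ v ∈ S, degIn G S v < 3 := by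
    refine Finset.exists_lt_of_sum_lt ?_
    rw [Finset.sum_const, smul_eq_mul, mul_comm]
    exact hdens S hS
  obtain ⟨h, hh⟩ := ih (S.erase v) (Finset.erase_ssubset hv)
  obtain ⟨c, hc⟩ : ∃ c, c ∉ (S.filter (G.Adj v)).image h := by
    by_contra! hall
    have h1 := Finset.card_le_card (fun c _ => hall c : Finset.univ ⊆ _)
    have h2 := Finset.card_image_le (s := S.filter (G.Adj v)) (f := h)
    rw [Finset.card_univ, Fintype.card_fin] at h1
    rw [degIn] at hlt
    omega
  have hcv : ∀ y ∈ S, G.Adj v y → h y ≠ c := fun y hy hvy hyc =>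
    hc (Finset.mem_image.2 ⟨y, Finset.mem_filter.2 ⟨hy, hvy⟩, hyc⟩)
  refine ⟨Function.update h v c, fun x hx y hy hxy => ?_⟩
  by_cases hxv : x = v
  · subst hxv
    rw [Function.update_self, Function.update_of_ne hxy.ne']
    exact (hcv y hy hxy).symm
  · rw [Function.update_of_ne hxv]
    by_cases hyv : y = v
    · subst hyv
      rw [Function.update_self]
      exact hcv x hx hxy.symm
    · rw [Function.update_of_ne hyv]
      exact hh x (Finset.mem_erase.2 ⟨hxv, hx⟩) y (Finset.mem_erase.2 ⟨hyv, hy⟩) hxy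

end Induction

theorem not_arrows_of_coloring_three {V W : Type*} (G : SimpleGraph V) (C : Digraph W)
    (hC : HasThreeWalk C)
    (h : V → Fin 3) (hh : ∀ x y, G.Adj x y → h x ≠ h y) : ¬ Arrows G C := by
  intro harr
  obtain ⟨f, -, hf⟩ := harr ⟨fun x y => G.Adj x y ∧ h x < h y⟩ (by
    constructor
    · intro x y
      constructor
      · intro hxy
        rcases lt_or_gt_of_ne (hh x y hxy) with h1 | h1
        · exact Or.inl ⟨hxy, h1⟩
        · exact Or.inr ⟨hxy.symm, h1⟩
      · rintro (h1 | h1)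
        · exact h1.1
        · exact h1.1.symm
    · exact fun x y h1 h2 => lt_asymm h1.2 h2.2)
  obtain ⟨x, y, z, w, h1, h2, h3⟩ := hC
  have h1 := (hf _ _ h1).2
  have h2 := (hf _ _ h2).2
  have h3 := (hf _ _ h3).2
  omega

/-! ### From maximum density to degree sums -/

theorem sum_degIn_eq {V : Type*} [Fintype V] [DecidableEq V] (G : SimpleGraph V)
    [DecidableRel G.Adj] (S : Finset V) :
    ∑ v ∈ S, degIn G S v = 2 * numEdges ((⊤ : G.Subgraph).induce (S : Set V)) := by
  classical
  set J := (⊤ : G.Subgraph).induce (S : Set V)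
  have h := J.spanningCoe.sum_degrees_eq_twice_card_edges
  have h1 : numEdges J = J.spanningCoe.edgeFinset.card := by
    rw [numEdges, ← SimpleGraph.Subgraph.edgeSet_spanningCoe, ← SimpleGraph.coe_edgeFinset,
      Set.ncard_coe_finset]
  rw [h1, ← h, ← Finset.sum_subset (Finset.subset_univ S)]
  · refine Finset.sum_congr rfl fun v hv => ?_
    rw [← SimpleGraph.card_neighborFinset_eq_degree, degIn]
    congr 1
    ext u
    simp [J, hv]
  · intro v _ hv
    rw [SimpleGraph.degree_eq_zero_iff_notMem_support]
    simp [J, SimpleGraph.mem_support, hv]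

theorem mul_sum_degIn_lt {V : Type*} [Fintype V] [DecidableEq V] (G : SimpleGraph V)
    [DecidableRel G.Adj] {n : ℕ} (hn : 0 < n)
    (h : maxDensity G < ((n : ℝ) + 1) / n) (S : Finset V) (hS : S.Nonempty) :
    n * ∑ v ∈ S, degIn G S v < 2 * (n + 1) * S.card := by
  have : Nonempty V := ⟨hS.choose⟩
  set J := (⊤ : G.Subgraph).induce (S : Set V) with hJ
  have hv : numVerts J = S.card := by simp [numVerts, hJ]
  have hpos : 0 < S.card := hS.card_pos
  have h1 : (numEdges J : ℝ) / S.card < ((n : ℝ) + 1) / n :=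
    lt_of_le_of_lt ((isGreatest_maxDensity G).2 ⟨J, by omega, by rw [hv]⟩) h
  rw [div_lt_div_iff₀ (by exact_mod_cast hpos) (by exact_mod_cast hn)] at h1
  have h2 : numEdges J * n < (n + 1) * S.card := by exact_mod_cast h1
  rw [sum_degIn_eq, ← hJ]
  linarith

/-! ### Cycles: 2-density and forks -/

section Cycle

theorem cycleGraph_adj_add_one {n : ℕ} (i : Fin (n + 2)) :
    (SimpleGraph.cycleGraph (n + 2)).Adj i (i + 1) := by
  rw [SimpleGraph.cycleGraph_adj]
  simp

theorem cycleGraph_adj_iff_add_one {n : ℕ} {i j : Fin (n + 2)} :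
    (SimpleGraph.cycleGraph (n + 2)).Adj i j ↔ i = j + 1 ∨ j = i + 1 := by
  rw [SimpleGraph.cycleGraph_adj, sub_eq_iff_eq_add, sub_eq_iff_eq_add, add_comm 1 j, add_comm 1 i]

theorem add_one_ne_sub_one {n : ℕ} (i : Fin (n + 3)) : i + 1 ≠ i - 1 := by
  intro h
  have h1 : (1 : Fin (n + 3)) + 1 = 0 := by
    have h2 : i + (1 + 1) = i + 0 := by
      rw [← add_assoc, h]; simp
    exact add_left_cancel h2
  have := congrArg Fin.val h1
  simp [Fin.val_add, Nat.mod_eq_of_lt] at this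

theorem cycleGraph_exists_adj_ne {n : ℕ} (i j : Fin (n + 3)) :
    ∃ k, k ≠ j ∧ (SimpleGraph.cycleGraph (n + 3)).Adj i k := by
  by_cases h : i + 1 = j
  · exact ⟨i - 1, fun h' => add_one_ne_sub_one i (h.trans h'.symm),
      cycleGraph_adj_iff_add_one.2 (Or.inl (by simp))⟩
  · exact ⟨i + 1, h, cycleGraph_adj_add_one i⟩

/-- Subgraphs of a cycle have at most as many edges as cyclically consecutive pairs of vertices. -/
theorem numEdges_cycleGraph_le {n : ℕ} (J : (SimpleGraph.cycleGraph (n + 2)).Subgraph) :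
    numEdges J ≤ {i | i ∈ J.verts ∧ i + 1 ∈ J.verts}.ncard := by
  refine le_trans (Set.ncard_le_ncard ?_ (Set.toFinite _))
    (Set.ncard_image_le (f := fun i => s(i, i + 1)) (Set.toFinite _))
  intro e he
  induction e with
  | h x y =>
  rw [SimpleGraph.Subgraph.mem_edgeSet] at he
  have hx := J.edge_vert he
  have hy := J.edge_vert he.symm
  rcases cycleGraph_adj_iff_add_one.1 he.adj_sub with rfl | rfl
  · exact ⟨y, ⟨hy, hx⟩, Sym2.eq_swap⟩
  · exact ⟨x, ⟨hx, hy⟩, rfl⟩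

-- With equality, the vertex set would be closed under adding 1, hence everything.
open Fin.CommRing in
theorem numEdges_cycleGraph_lt {n : ℕ} (J : (SimpleGraph.cycleGraph (n + 2)).Subgraph)
    (hne : J.verts.Nonempty) (hJ : J.verts ≠ Set.univ) : numEdges J < numVerts J := by
  refine lt_of_le_of_lt (numEdges_cycleGraph_le J)
    (Set.ncard_lt_ncard ⟨fun i hi => hi.1, fun hsub => hJ ?_⟩ (Set.toFinite _))
  obtain ⟨i, hi⟩ := hne
  have hk : ∀ k : ℕ, i + k • (1 : Fin (n + 2)) ∈ J.verts := by
    intro k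
    induction k with
    | zero => simpa using hi
    | succ k ih =>
      have := (hsub ih).2
      rwa [add_assoc, ← succ_nsmul] at this
  refine Set.eq_univ_of_forall fun j => ?_
  have := hk (j - i).val
  rwa [nsmul_one, Fin.cast_val_eq_self, add_sub_cancel] at this

theorem numEdges_top_cycleGraph (n : ℕ) :
    numEdges (⊤ : (SimpleGraph.cycleGraph (n + 3)).Subgraph) = n + 3 := by
  have h := (SimpleGraph.cycleGraph (n + 3)).sum_degrees_eq_twice_card_edges
  simp only [SimpleGraph.cycleGraph_degree_three_le, Finset.sum_const, Finset.card_univ,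
    Fintype.card_fin, smul_eq_mul] at h
  rw [numEdges, SimpleGraph.Subgraph.edgeSet_top, ← SimpleGraph.coe_edgeFinset,
    Set.ncard_coe_finset]
  omega

theorem maxTwoDensity_cycleGraph (n : ℕ) :
    maxTwoDensity (SimpleGraph.cycleGraph (n + 3)) = ((n : ℝ) + 2) / (n + 1) := by
  refine (isGreatest_maxTwoDensity (by simp) _).unique ⟨⟨⊤, ?_, ?_⟩, ?_⟩
  · simp [numVerts, Set.ncard_univ]
  · rw [numEdges_top_cycleGraph]
    simp only [numVerts, SimpleGraph.Subgraph.verts_top, Set.ncard_univ, Nat.card_fin]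
    push_cast
    congr 1 <;> ring
  · rintro r ⟨J, hJ, rfl⟩
    have hn : (0 : ℝ) < n + 1 := by positivity
    have hJ' : (3 : ℝ) ≤ numVerts J := by exact_mod_cast hJ
    by_cases huniv : J.verts = Set.univ
    · have hv : numVerts J = n + 3 := by simp [numVerts, huniv, Set.ncard_univ]
      have he : numEdges J ≤ n + 3 := by
        exact ((numEdges_cycleGraph_le J).trans
          (Set.ncard_le_ncard (fun i hi => hi.1) (Set.toFinite _))).trans hv.le
      have he' : (numEdges J : ℝ) ≤ n + 3 := by exact_mod_cast he
      rw [hv]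
      push_cast
      rw [show (n : ℝ) + 3 - 2 = n + 1 by ring]
      gcongr
      linarith
    · have hlt := numEdges_cycleGraph_lt J
        (Set.nonempty_of_ncard_ne_zero (by rw [numVerts] at hJ; omega)) huniv
      have hlt' : (numEdges J : ℝ) + 1 ≤ numVerts J := by exact_mod_cast hlt
      calc ((numEdges J : ℝ) - 1) / ((numVerts J : ℝ) - 2) ≤ 1 := by
            rw [div_le_one (by linarith)]; linarith
        _ ≤ _ := by rw [le_div_iff₀ hn]; linarith

variable {n : ℕ} {C : Digraph (Fin (n + 3))}

theorem IsOrientation.adj_add_one_iff (hC : IsOrientation C (SimpleGraph.cycleGraph (n + 3)))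
    (i : Fin (n + 3)) : C.Adj (i + 1) i ↔ ¬ C.Adj i (i + 1) := by
  have h := (hC.adj_iff i (i + 1)).1 (cycleGraph_adj_add_one i)
  have := hC.asymm i (i + 1)
  tauto

theorem IsOrientation.eq_add_one_or (hC : IsOrientation C (SimpleGraph.cycleGraph (n + 3)))
    {i j : Fin (n + 3)} (h : C.Adj i j ∨ C.Adj j i) : j = i + 1 ∨ i = j + 1 :=
  (cycleGraph_adj_iff_add_one.1 ((hC.adj_iff i j).2 h)).symm

/-- Writing T for a forward arc and F for a backward one, an out-fork reads FFTT around the cycle.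
An out-fork of the reverse reads TTFF in the same word. -/
theorem exists_of_hasOutFork (hC : IsOrientation C (SimpleGraph.cycleGraph (n + 3)))
    (h : HasOutFork C) : ∃ i, ¬ C.Adj i (i + 1) ∧ ¬ C.Adj (i + 1) (i + 1 + 1) ∧
      C.Adj (i + 1 + 1) (i + 1 + 1 + 1) ∧ C.Adj (i + 1 + 1 + 1) (i + 1 + 1 + 1 + 1) := by
  have main : ∀ p y q x z : Fin (n + 3), x = y + 1 → y = z + 1 → C.Adj y x → C.Adj x p →
      C.Adj y z → C.Adj z q → ∃ i, ¬ C.Adj i (i + 1) ∧ ¬ C.Adj (i + 1) (i + 1 + 1) ∧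
      C.Adj (i + 1 + 1) (i + 1 + 1 + 1) ∧ C.Adj (i + 1 + 1 + 1) (i + 1 + 1 + 1 + 1) := by
    rintro p y q x z rfl rfl h1 h2 h3 h4
    have hp : p = z + 1 + 1 + 1 := by
      rcases hC.eq_add_one_or (Or.inl h2) with h | h
      · exact h
      · rw [← add_right_cancel h] at h2
        exact absurd h2 (hC.asymm _ _ h1)
    have hq : z = q + 1 := by
      rcases hC.eq_add_one_or (Or.inl h4) with h | h
      · rw [h] at h4
        exact absurd h4 (hC.asymm _ _ h3)
      · exact h
    subst hp hq
    exact ⟨q, (hC.adj_add_one_iff _).1 h4, (hC.adj_add_one_iff _).1 h3, h1, h2⟩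
  obtain ⟨p, x, y, z, q, hxz, h1, h2, h3, h4⟩ := h
  rcases hC.eq_add_one_or (Or.inl h1) with hx | hx <;>
    rcases hC.eq_add_one_or (Or.inl h3) with hz | hz
  · exact absurd (hx.trans hz.symm) hxz
  · exact main p y q x z hx hz h1 h2 h3 h4
  · exact main q y p z x hz hx h3 h4 h1 h2
  · exact absurd (add_left_injective _ (hx.symm.trans hz)) hxz

/-- In a cyclic word without three equal consecutive letters, the factors `FFTT` and `TTFF` do not
both occur, if the length is five. -/
theorem no_two_forks_five : ∀ P : Fin 5 → Bool,
    (∀ i, ¬ (P i ∧ P (i + 1) ∧ P (i + 1 + 1))) →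
    (∀ i, ¬ (¬ P i ∧ ¬ P (i + 1) ∧ ¬ P (i + 1 + 1))) →
    (∃ i, ¬ P i ∧ ¬ P (i + 1) ∧ P (i + 1 + 1) ∧ P (i + 1 + 1 + 1)) →
    ¬ ∃ j, ¬ ¬ P j ∧ ¬ ¬ P (j + 1) ∧ ¬ P (j + 1 + 1) ∧ ¬ P (j + 1 + 1 + 1) := by
  decide

-- In length six, FFTT can only be completed to FFTTFT, which has no cyclic factor TTFF.
set_option maxRecDepth 100000 in
theorem no_two_forks_six : ∀ P : Fin 6 → Bool,
    (∀ i, ¬ (P i ∧ P (i + 1) ∧ P (i + 1 + 1))) →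
    (∀ i, ¬ (¬ P i ∧ ¬ P (i + 1) ∧ ¬ P (i + 1 + 1))) →
    (∃ i, ¬ P i ∧ ¬ P (i + 1) ∧ P (i + 1 + 1) ∧ P (i + 1 + 1 + 1)) →
    ¬ ∃ j, ¬ ¬ P j ∧ ¬ ¬ P (j + 1) ∧ ¬ P (j + 1 + 1) ∧ ¬ P (j + 1 + 1 + 1) := by
  decide

theorem not_hasOutFork_or_reverse (hn : n = 2 ∨ n = 3)
    (hC : IsOrientation C (SimpleGraph.cycleGraph (n + 3))) (hpath : ¬ HasThreeWalk C) :
    ¬ HasOutFork C ∨ ¬ HasOutFork (reverse C) := by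
  classical
  by_contra! hcon
  obtain ⟨i, hi1, hi2, hi3, hi4⟩ := exists_of_hasOutFork hC hcon.1
  obtain ⟨j, hj1, hj2, hj3, hj4⟩ := exists_of_hasOutFork hC.reverse hcon.2
  have hrev : ∀ i, (reverse C).Adj i (i + 1) ↔ ¬ C.Adj i (i + 1) := hC.adj_add_one_iff
  rw [hrev] at hj1 hj2 hj3 hj4
  have hf : ∀ i, ¬ (C.Adj i (i + 1) ∧ C.Adj (i + 1) (i + 1 + 1) ∧
      C.Adj (i + 1 + 1) (i + 1 + 1 + 1)) :=
    fun i h => hpath ⟨_, _, _, _, h.1, h.2.1, h.2.2⟩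
  have hb : ∀ i, ¬ (¬ C.Adj i (i + 1) ∧ ¬ C.Adj (i + 1) (i + 1 + 1) ∧
      ¬ C.Adj (i + 1 + 1) (i + 1 + 1 + 1)) := by
    intro i h
    rw [← hC.adj_add_one_iff, ← hC.adj_add_one_iff, ← hC.adj_add_one_iff] at h
    exact hpath ⟨_, _, _, _, h.2.2, h.2.1, h.1⟩
  let P : Fin (n + 3) → Bool := fun i => decide (C.Adj i (i + 1))
  have hP : ∀ i, C.Adj i (i + 1) ↔ P i = true := fun i => by simp [P]
  simp only [hP] at *
  generalize P = Q at *
  rcases hn with rfl | rfl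
  · exact no_two_forks_five Q hf hb ⟨i, hi1, hi2, hi3, hi4⟩ ⟨j, hj1, hj2, hj3, hj4⟩
  · exact no_two_forks_six Q hf hb ⟨i, hi1, hi2, hi3, hi4⟩ ⟨j, hj1, hj2, hj3, hj4⟩

end Cycle

end OrientationRamsey

/-! ### Assembling the cases -/

theorem theorem13 (ℓ : ℕ) (hℓ : 5 ≤ ℓ) :
    OrientationRamsey.maxTwoDensity (SimpleGraph.cycleGraph ℓ) = ((ℓ : ℝ) - 1) / ((ℓ : ℝ) - 2) ∧
    ∀ C : Digraph (Fin ℓ), OrientationRamsey.IsOrientation C (SimpleGraph.cycleGraph ℓ) →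
      ∀ (V : Type*) [Finite V] (G : SimpleGraph V),
        OrientationRamsey.maxDensity G <
            OrientationRamsey.maxTwoDensity (SimpleGraph.cycleGraph ℓ) →
          ¬ OrientationRamsey.Arrows G C := by
  classical
  obtain ⟨n, rfl⟩ : ∃ n, ℓ = n + 3 := ⟨ℓ - 3, by omega⟩
  have hm := OrientationRamsey.maxTwoDensity_cycleGraph n
  refine ⟨?_, fun C hC V _ G hG harr => ?_⟩
  · rw [hm]
    push_cast
    congr 1 <;> ring
  have := Fintype.ofFinite V
  have hdens := OrientationRamsey.mul_sum_degIn_lt G (n := n + 1) (by omega) (by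
    rw [hm] at hG
    refine hG.trans_eq ?_
    push_cast
    congr 1
    ring)
  by_cases hpath : OrientationRamsey.HasThreeWalk C
  · obtain ⟨h, hh⟩ := OrientationRamsey.exists_coloring_three G (fun S hS => by
      have h1 := hdens S hS
      have h2 := hS.card_pos
      nlinarith) Finset.univ
    exact OrientationRamsey.not_arrows_of_coloring_three G C hpath h
      (fun x y => hh x (Finset.mem_univ x) y (Finset.mem_univ y)) harr
  have hG' : OrientationRamsey.restrict G Finset.univ = G := by
    ext x y
    simp [OrientationRamsey.restrict]
  have main : ∀ C' : Digraph (Fin (n + 3)),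
      OrientationRamsey.IsOrientation C' (SimpleGraph.cycleGraph (n + 3)) →
      ¬ OrientationRamsey.HasThreeWalk C' → (5 ≤ n + 1 ∨ ¬ OrientationRamsey.HasOutFork C') →
      ∃ D : Digraph V, OrientationRamsey.IsOrientation D G ∧
        ¬ OrientationRamsey.ContainsCopy D C' := by
    intro C' hC' hp hf
    have := OrientationRamsey.exists_orientation_restrict G (by omega) hdens C' _ hC'
      OrientationRamsey.cycleGraph_exists_adj_ne hp hf Finset.univ
    rwa [hG'] at this
  -- Here n + 1 = ℓ - 2, so the first alternative fails only for ℓ = 5, 6.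
  have hcase : (5 ≤ n + 1 ∨ ¬ OrientationRamsey.HasOutFork C) ∨
      ¬ OrientationRamsey.HasOutFork (OrientationRamsey.reverse C) := by
    by_cases h5 : 5 ≤ n + 1
    · exact Or.inl (Or.inl h5)
    · rcases OrientationRamsey.not_hasOutFork_or_reverse (by omega) hC hpath with h | h
      · exact Or.inl (Or.inr h)
      · exact Or.inr h
  rcases hcase with h | h
  · obtain ⟨D, hD, hcopy⟩ := main C hC hpath h
    exact hcopy (harr D hD)
  · obtain ⟨D, hD, hcopy⟩ := main (OrientationRamsey.reverse C) hC.reverse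
      (fun ⟨x, y, z, w, h1, h2, h3⟩ => hpath ⟨w, z, y, x, h3, h2, h1⟩) (Or.inr h)
    exact hcopy (harr _ hD.reverse).reverse
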